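/- Let $d\ge 2$, fix the standard basis of $\mathbb C^d$, and write $\mathcal L(H)$ for the linear operators on a finite-dimensional Hilbert space $H$. A linear map between such operator spaces is CPTP (a channel) if it is completely positive and trace preserving. For a linear map $\mathcal N:\mathcal L(A)\to\mathcal L(C)$, $\mathcal N^\dagger$ denotes its adjoint for the Hilbert–Schmidt inner product $\langle X,Y\rangle=\operatorname{Tr}(X^\dagger Y)$. If $\mathcal N$ is completely positive, put $$\upsilon_2(\mathcal N)=\sup_{\Lambda}\bigl\|(\mathcal N\otimes\mathrm{id}_E)\bigl((\mathrm{id}_A\otimes\Lambda)(|\Phi\rangle\langle\Phi|)\bigr)\bigr\|_2,$$ where $\|X\|_2=(\operatorname{Tr}X^\dagger X)^{1/2}$, $|\Phi\rangle=(\dim A)^{-1/2}\sum_i|i\rangle\otimes|i\rangle\in A\otimes A'$ is the normalized maximally entangled vector, $A'$ is a copy of $A$, and the supremum is over all finite-dimensional systems $E$ and all CPTP maps $\Lambda:\mathcal L(A')\to\mathcal L(E)$. For $A=(\mathbb C^d)^{\otimes n}$ the product basis is used. For $0\le p\le \frac{d^2}{d^2-1}$ and $-\frac1{d-1}\le t\le\frac1{d+1}$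 define, for $X\in\mathcal L(\mathbb C^d)$, $$\Delta_p(X)=(1-p)X+\tfrac pd\operatorname{Tr}(X)I_d,\qquad \Gamma_t(X)=tX^T+(1-t)\operatorname{Tr}(X)\tfrac{I_d}{d},$$ and the maps $\mathcal L(\mathbb C^d)\to\mathcal L(\mathbb C^d\otimes\mathbb C^d)$ $$\Delta_p^c(X)=P_p(X\otimes I_d)P_p^\dagger,\qquad \Gamma_t^c(X)=S_t(X\otimes I_d)S_t^\dagger,$$ where $$P_p=\sqrt{\tfrac pd}\,I+\sqrt d\Bigl(-\tfrac{\sqrt p}{d}+\sqrt{1-p\,\tfrac{d^2-1}{d^2}}\Bigr)|\Phi_d\rangle\langle\Phi_d|,\qquad |\Phi_d\rangle=\tfrac1{\sqrt d}\sum_{i=1}^d|i\rangle\otimes|i\rangle,$$ $$S_t=(a^++a^-)I+(a^+-a^-)\Pi,\qquad a^+=\sqrt{\tfrac{1+(d-1)t}{4d}},\quad a^-=\sqrt{\tfrac{1-(d+1)t}{4d}},$$ and $\Pi$ is the flip operator on $\mathbb C^d\otimes\mathbb C^d$. Then the following hold. 1. $\Delta_p,\Gamma_t,\Delta_p^c,\Gamma_t^c$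 are CPTP, and $\Delta_p^c$, $\Gamma_t^c$ are complementary channels of $\Delta_p$, $\Gamma_t$ respectively; that is, for $\mathcal N\in\{\Delta_p,\Gamma_t\}$ there is an isometry $V:\mathbb C^d\to\mathbb C^d\otimes K$ with $K=\mathbb C^d\otimes\mathbb C^d$ such that $\mathcal N(X)=\operatorname{Tr}_K(VXV^\dagger)$ and $\mathcal N^c(X)=\operatorname{Tr}_{\mathbb C^d}(VXV^\dagger)$, the latter trace being over the first tensor factor. 2. Each of the four maps satisfies $\mathcal N^\dagger\circ\mathcal N=a\,\mathrm{id}+b\operatorname{Tr}[\cdot]I_d$ with $a,b\ge0$, namely $$\Delta_p^\dagger\circ\Delta_p=(1-p)^2\,\mathrm{id}+\tfrac{p(2-p)}{d}\operatorname{Tr}[\cdot]I_d,\qquad (\Delta_p^c)^\dagger\circ\Delta_p^c=\tfrac{p(2-p)}{d}\,\mathrm{id}+(1-p)^2\operatorname{Tr}[\cdot]I_d,$$ $$\Gamma_t^\dagger\circ\Gamma_t=t^2\,\mathrm{id}+\tfrac{1-t^2}{d}\operatorname{Tr}[\cdot]I_d,\qquad (\Gamma_t^c)^\dagger\circ\Gamma_t^c=\tfrac{1-t^2}{d}\,\mathrm{id}+t^2\operatorname{Tr}[\cdot]I_d.$$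 3. For each $\mathcal N\in\{\Delta_p,\Gamma_t,\Delta_p^c,\Gamma_t^c\}$ and every $n\in\mathbb N$, $\upsilon_2(\mathcal N^{\otimes n})$ is finite and $$\upsilon_2(\mathcal N^{\otimes n})=\bigl(\upsilon_2(\mathcal N)\bigr)^n .$$ -/

import Mathlib

namespace QuantumChannel

open Matrix
open scoped Kronecker ComplexOrder

noncomputable section

variable {ι κ ι' κ' : Type*}

/-- A linear map `L(ℂ^ι) → L(ℂ^κ)`; operators are written as matrices in the fixed bases. -/
abbrev SuperOp (ι κ : Type*) := Matrix ι ι ℂ →ₗ[ℂ] Matrix κ κ ℂ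

/-- The tensor product `Φ ⊗ Ψ` of two linear maps, obtained by expanding the argument in the
matrix units `E_{ii'} ⊗ E_{jj'}`. -/
def tensorMap [Fintype ι] [DecidableEq ι] [Fintype ι'] [DecidableEq ι']
    (Φ : SuperOp ι κ) (Ψ : SuperOp ι' κ') :
    SuperOp (ι × ι') (κ × κ') where
  toFun X := ∑ i, ∑ i', ∑ j, ∑ j', X (i, j) (i', j') •
    (Φ (Matrix.single i i' 1) ⊗ₖ Ψ (Matrix.single j j' 1))
  map_add' X Y := by simp only [Matrix.add_apply, add_smul, Finset.sum_add_distrib]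
  map_smul' c X := by
    simp only [Matrix.smul_apply, smul_eq_mul, mul_smul, Finset.smul_sum, RingHom.id_apply]

/-- The tensor power `N^{⊗n}`. The product basis of the `n`-fold tensor power of `ℂ^ι` is indexed by
`Fin n → ι`, and `E_{g₁g₁'} ⊗ ⋯ ⊗ E_{gₙgₙ'}` is sent to `N(E_{g₁g₁'}) ⊗ ⋯ ⊗ N(E_{gₙgₙ'})`. -/
def tensorPower [Fintype ι] [DecidableEq ι] (N : SuperOp ι κ) (n : ℕ) :
    SuperOp (Fin n → ι) (Fin n → κ) where
  toFun X := ∑ g, ∑ g', X g g' •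
    Matrix.of fun f f' => ∏ k, N (Matrix.single (g k) (g' k) 1) (f k) (f' k)
  map_add' X Y := by simp only [Matrix.add_apply, add_smul, Finset.sum_add_distrib]
  map_smul' c X := by
    simp only [Matrix.smul_apply, smul_eq_mul, mul_smul, Finset.smul_sum, RingHom.id_apply]

/-- Complete positivity: every ampliation `Φ ⊗ id_k` preserves positive semidefiniteness. -/
def IsCP [Fintype ι] [DecidableEq ι] (Φ : SuperOp ι κ) : Prop :=
  ∀ (k : ℕ) (X : Matrix (ι × Fin k) (ι × Fin k) ℂ), X.PosSemidef →
    (tensorMap Φ (LinearMap.id : SuperOp (Fin k) (Fin k)) X).PosSemidef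

/-- Completely positive and trace preserving maps (quantum channels). -/
def IsCPTP [Fintype ι] [DecidableEq ι] [Fintype κ] (Φ : SuperOp ι κ) : Prop :=
  IsCP Φ ∧ ∀ X, (Φ X).trace = X.trace

/-- The Hilbert–Schmidt adjoint `N†`, with `⟨A, B⟩ = Tr(A† B)`. -/
def hsAdjoint [DecidableEq ι] [Fintype κ] (N : SuperOp ι κ) : SuperOp κ ι where
  toFun Y := Matrix.of fun i j => ((N (Matrix.single i j 1))ᴴ * Y).trace
  map_add' Y Z := by ext; simp [Matrix.mul_add]
  map_smul' c Y := by ext; simp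

/-- The defining property of the Hilbert–Schmidt adjoint: `Tr[Y† N(X)] = Tr[(N†(Y))† X]`. -/
theorem trace_hsAdjoint [Fintype ι] [DecidableEq ι] [Fintype κ] (N : SuperOp ι κ)
    (X : Matrix ι ι ℂ) (Y : Matrix κ κ ℂ) :
    (Yᴴ * N X).trace = ((hsAdjoint N Y)ᴴ * X).trace := by
  have h : ∀ i j, (hsAdjoint N Y)ᴴ j i = (Yᴴ * N (Matrix.single i j 1)).trace := by
    intro i j
    change star (((N (Matrix.single i j 1))ᴴ * Y).trace) = _
    rw [← Matrix.trace_conjTranspose, Matrix.conjTranspose_mul, Matrix.conjTranspose_conjTranspose]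
  have hX : N X = ∑ i, ∑ j, X i j • N (Matrix.single i j 1) := by
    conv_lhs => rw [Matrix.matrix_eq_sum_single X]
    simp only [map_sum]
    refine Finset.sum_congr rfl fun i _ => Finset.sum_congr rfl fun j _ => ?_
    rw [← map_smul, Matrix.smul_single, smul_eq_mul, mul_one]
  rw [hX]
  simp only [Matrix.mul_sum, Matrix.mul_smul, Matrix.trace_sum, Matrix.trace_smul, ← h, smul_eq_mul]
  rw [Finset.sum_comm]
  simp only [Matrix.trace, Matrix.diag_apply, Matrix.mul_apply, mul_comm]

/-- The Schatten 2-norm `‖X‖₂ = (Tr X†X)^{1/2}`. -/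
def schattenTwo [Fintype ι] (X : Matrix ι ι ℂ) : ℝ :=
  Real.sqrt (Xᴴ * X).trace.re

/-- The normalized maximally entangled vector `|Φ⟩ = |ι|^{-1/2} ∑ᵢ |i⟩ ⊗ |i⟩`. -/
def maxEntVec (ι : Type*) [Fintype ι] [DecidableEq ι] : ι × ι → ℂ :=
  fun x => if x.1 = x.2 then ((Real.sqrt (Fintype.card ι))⁻¹ : ℝ) else 0

/-- The normalized maximally entangled state `|Φ⟩⟨Φ|`. -/
def maxEnt (ι : Type*) [Fintype ι] [DecidableEq ι] : Matrix (ι × ι) (ι × ι) ℂ :=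
  Matrix.vecMulVec (maxEntVec ι) (star (maxEntVec ι))

/-- The set of values `‖(Ω ⊗ id_E)((id ⊗ Λ)(|Φ⟩⟨Φ|))‖₂`, for CPTP maps `Λ` into `L(E)` with `E` an
arbitrary finite-dimensional system. -/
def upsilonTwoValues [Fintype ι] [DecidableEq ι] [Fintype κ] (Ω : SuperOp ι κ) : Set ℝ :=
  {r | ∃ (m : ℕ) (Λ : SuperOp ι (Fin m)), IsCPTP Λ ∧
    r = schattenTwo (tensorMap Ω (LinearMap.id : SuperOp (Fin m) (Fin m))
      (tensorMap (LinearMap.id : SuperOp ι ι) Λ (maxEnt ι)))}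

/-- The quantity `υ₂(Ω)`. -/
def upsilonTwo [Fintype ι] [DecidableEq ι] [Fintype κ] (Ω : SuperOp ι κ) : ℝ := sSup (upsilonTwoValues Ω)

/-- `υ₂` is multiplicative under tensor powers of `N`; the suprema `υ₂(N^{⊗n})` are finite. -/
def UpsilonTwoMultiplicative [Fintype ι] [DecidableEq ι] [Fintype κ] (N : SuperOp ι κ) : Prop :=
  BddAbove (upsilonTwoValues N) ∧
    ∀ n : ℕ, BddAbove (upsilonTwoValues (tensorPower N n)) ∧
      upsilonTwo (tensorPower N n) = upsilonTwo N ^ n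

/-- `a, b ≥ 0` and `N† ∘ N = a id + b Tr[·] I`. -/
def AdjointSquare [Fintype ι] [DecidableEq ι] [Fintype κ] (N : SuperOp ι κ) (a b : ℝ) : Prop :=
  0 ≤ a ∧ 0 ≤ b ∧ ∀ X, (hsAdjoint N ∘ₗ N) X = (a : ℂ) • X + (b : ℂ) • X.trace • 1

/-- Partial trace over the first factor. -/
def traceFst [Fintype ι] (X : Matrix (ι × κ) (ι × κ) ℂ) : Matrix κ κ ℂ :=
  Matrix.of fun k l => ∑ i, X (i, k) (i, l)

/-- Partial trace over the second factor. -/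
def traceSnd [Fintype κ] (X : Matrix (ι × κ) (ι × κ) ℂ) : Matrix ι ι ℂ :=
  Matrix.of fun i j => ∑ k, X (i, k) (j, k)

/-- `Nc` is a complementary channel of `N`: for some Stinespring isometry `V : ℂ^ι → ℂ^κ ⊗ ℂ^κ'`,
`N(X) = Tr₂(V X V†)` and `Nc(X) = Tr₁(V X V†)`. -/
def IsComplementary [Fintype ι] [DecidableEq ι] [Fintype κ] [Fintype κ']
    (N : SuperOp ι κ) (Nc : SuperOp ι κ') : Prop :=
  ∃ V : Matrix (κ × κ') ι ℂ, Vᴴ * V = 1 ∧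
    ∀ X, N X = traceSnd (V * X * Vᴴ) ∧ Nc X = traceFst (V * X * Vᴴ)

/-- The depolarizing channel `Δ_p(X) = (1 - p) X + (p/d) Tr(X) I`. -/
def depol (d : ℕ) (p : ℝ) : SuperOp (Fin d) (Fin d) where
  toFun X := ((1 - p : ℝ) : ℂ) • X + ((p / d : ℝ) : ℂ) • X.trace • 1
  map_add' X Y := by rw [Matrix.trace_add]; module
  map_smul' c X := by rw [Matrix.trace_smul, RingHom.id_apply, smul_eq_mul]; module

/-- The transpose-depolarizing channel `Γ_t(X) = t Xᵀ + (1 - t) Tr(X) I/d`. -/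
def transDepol (d : ℕ) (t : ℝ) : SuperOp (Fin d) (Fin d) where
  toFun X := (t : ℂ) • Xᵀ + (((1 - t) / d : ℝ) : ℂ) • X.trace • 1
  map_add' X Y := by rw [Matrix.trace_add, Matrix.transpose_add]; module
  map_smul' c X := by
    rw [Matrix.trace_smul, Matrix.transpose_smul, RingHom.id_apply, smul_eq_mul]; module

/-- The map `X ↦ S (X ⊗ I) S†` from `L(ℂ^d)` to `L(ℂ^d ⊗ ℂ^d)`. -/
def conjAmp (d : ℕ) (S : Matrix (Fin d × Fin d) (Fin d × Fin d) ℂ) :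
    SuperOp (Fin d) (Fin d × Fin d) where
  toFun X := S * (X ⊗ₖ (1 : Matrix (Fin d) (Fin d) ℂ)) * Sᴴ
  map_add' X Y := by rw [Matrix.add_kronecker, Matrix.mul_add, Matrix.add_mul]
  map_smul' c X := by
    rw [Matrix.smul_kronecker, Matrix.mul_smul, Matrix.smul_mul, RingHom.id_apply]

/-- The flip operator `Π (x ⊗ y) = y ⊗ x` on `ℂ^d ⊗ ℂ^d`. -/
def flipOp (d : ℕ) : Matrix (Fin d × Fin d) (Fin d × Fin d) ℂ :=
  Matrix.of fun x y => if x = y.swap then 1 else 0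

/-- `S_t = (a⁺ + a⁻) I + (a⁺ - a⁻) Π`, where `a⁺ = √((1 + (d-1)t)/(4d))` and
`a⁻ = √((1 - (d+1)t)/(4d))`. -/
def opS (d : ℕ) (t : ℝ) : Matrix (Fin d × Fin d) (Fin d × Fin d) ℂ :=
  ((Real.sqrt ((1 + ((d : ℝ) - 1) * t) / (4 * d)) +
      Real.sqrt ((1 - ((d : ℝ) + 1) * t) / (4 * d)) : ℝ) : ℂ) • 1 +
    ((Real.sqrt ((1 + ((d : ℝ) - 1) * t) / (4 * d)) -
      Real.sqrt ((1 - ((d : ℝ) + 1) * t) / (4 * d)) : ℝ) : ℂ) • flipOp d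

/-- `P_p = √(p/d) I + √d (-√p/d + √(1 - p(d²-1)/d²)) |Φ_d⟩⟨Φ_d|`. -/
def opP (d : ℕ) (p : ℝ) : Matrix (Fin d × Fin d) (Fin d × Fin d) ℂ :=
  (Real.sqrt (p / d) : ℂ) • 1 +
    ((Real.sqrt d * (-(Real.sqrt p / d) +
      Real.sqrt (1 - p * (((d : ℝ) ^ 2 - 1) / (d : ℝ) ^ 2))) : ℝ) : ℂ) • maxEnt (Fin d)

/-- `Γ_t^c(X) = S_t (X ⊗ I) S_t†`, the Datta–Fukuda–Holevo form of the complementary channel. -/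
def transDepolCompl (d : ℕ) (t : ℝ) : SuperOp (Fin d) (Fin d × Fin d) := conjAmp d (opS d t)

/-- `Δ_p^c(X) = P_p (X ⊗ I) P_p†`, the Datta–Fukuda–Holevo form of the complementary channel. -/
def depolCompl (d : ℕ) (p : ℝ) : SuperOp (Fin d) (Fin d × Fin d) := conjAmp d (opP d p)

end

end QuantumChannel

namespace QuantumChannel

open Matrix
open scoped Kronecker ComplexOrder

noncomputable section

variable {ι κ ι' κ' : Type*}

/-! Multiplicativity uses only `N† N = a id + b Tr[·] I` with `a, b ≥ 0`. Write `d` for the input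
dimension. Let ρ be the state fed to `N^{⊗n} ⊗ id_E`, purified by ψ on A E R. Expanding `(N†
N)^{⊗n}` turns the squared 2-norm of the output into a sum over sets S of inputs of `a^|S|
b^(n-|S|)` times the purity of ρ on S E (`HasPowerGram.trace_eq_sum_swapExp`). A purity is the
expectation of a partial swap in ψ ⊗ ψ.

It remains to remove E. The partial swaps form the group (ℤ/2)^(n+2), and every isotypic component
of ψ ⊗ ψ has nonnegative squared norm (`sum_boolSign_mul_swapExp_nonneg`). A suitable positive
combination of these norms bounds the sum by one over purities of input marginals alone
(`sum_boolWeight_swapExp_le` and its primed form, for `b ≤ a` and `a ≤ b`). The input marginal is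
maximally mixed, so those purities are `d^(-|S|)` and the bound is the n-th power of `max (a + b/d)
(a/d + b)`. The identity and the trace channel attain the two entries (`HasPowerGram.isGreatest`).

For the four concrete maps, `N† N` is computed directly for `Δ_p` and `Γ_t`. Passing to a
complementary channel exchanges `a` and `b` (`IsComplementary.adjointSquare`), and complementarity
also yields the channel property. -/

/-! ### Coordinates of tensor products, Kraus forms and complete positivity. -/

theorem sum_sum_comm_sum_sum {α β γ δ M : Type*} [Fintype α] [Fintype β] [Fintype γ] [Fintype δ]
    [AddCommMonoid M] (f : α → β → γ → δ → M) :
    ∑ x, ∑ y, ∑ z, ∑ w, f x y z w = ∑ z, ∑ w, ∑ x, ∑ y, f x y z w := by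
  have := Finset.sum_comm (s := (Finset.univ : Finset (α × β)))
    (t := (Finset.univ : Finset (γ × δ))) (f := fun p q => f p.1 p.2 q.1 q.2)
  simpa only [Fintype.sum_prod_type] using this

theorem tensorMap_id_right_apply [Fintype ι] [DecidableEq ι] [Fintype ι'] [DecidableEq ι']
    (Φ : SuperOp ι κ) (X : Matrix (ι × ι') (ι × ι') ℂ) (k l : κ) (j j' : ι') :
    tensorMap Φ (LinearMap.id : SuperOp ι' ι') X (k, j) (l, j') =
      ∑ i, ∑ i', X (i, j) (i', j') * Φ (single i i' 1) k l := by
  simp only [tensorMap, LinearMap.coe_mk, AddHom.coe_mk, Matrix.sum_apply, Matrix.smul_apply,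
    kroneckerMap_apply, LinearMap.id_apply, smul_eq_mul]
  refine Finset.sum_congr rfl fun i _ => Finset.sum_congr rfl fun i' _ => ?_
  rw [Finset.sum_eq_single j, Finset.sum_eq_single j'] <;> simp +contextual [single]

theorem tensorMap_id_left_apply [Fintype ι] [DecidableEq ι] [Fintype ι'] [DecidableEq ι']
    (Ψ : SuperOp ι' κ') (X : Matrix (ι × ι') (ι × ι') ℂ) (k l : κ') (i i' : ι) :
    tensorMap (LinearMap.id : SuperOp ι ι) Ψ X (i, k) (i', l) =
      ∑ j, ∑ j', X (i, j) (i', j') * Ψ (single j j' 1) k l := by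
  simp only [tensorMap, LinearMap.coe_mk, AddHom.coe_mk, Matrix.sum_apply, Matrix.smul_apply,
    kroneckerMap_apply, LinearMap.id_apply, smul_eq_mul]
  rw [Finset.sum_eq_single i, Finset.sum_eq_single i'] <;> simp +contextual [single]

theorem map_apply_eq_sum [Fintype ι] [DecidableEq ι] (Φ : SuperOp ι κ) (X : Matrix ι ι ℂ)
    (k l : κ) : Φ X k l = ∑ i, ∑ i', X i i' * Φ (single i i' 1) k l := by
  conv_lhs => rw [Matrix.matrix_eq_sum_single X]
  simp only [map_sum, Matrix.sum_apply]
  refine Finset.sum_congr rfl fun i _ => Finset.sum_congr rfl fun j _ => ?_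
  rw [show single i j (X i j) = X i j • single i j (1 : ℂ) by simp, map_smul]
  rfl

/-- A map with a Kraus decomposition is completely positive. -/
theorem isCP_of_kraus {ν : Type*} [Fintype ι] [DecidableEq ι] [Fintype κ] [Fintype ν]
    (Φ : SuperOp ι κ) (K : ν → Matrix κ ι ℂ) (hΦ : ∀ X, Φ X = ∑ m, K m * X * (K m)ᴴ) :
    IsCP Φ := by
  intro k X hX
  have h : tensorMap Φ (LinearMap.id : SuperOp (Fin k) (Fin k)) X =
      ∑ m, (K m ⊗ₖ (1 : Matrix (Fin k) (Fin k) ℂ)) * X *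
        (K m ⊗ₖ (1 : Matrix (Fin k) (Fin k) ℂ))ᴴ := by
    ext ⟨a, j⟩ ⟨b, j'⟩
    have hb := map_apply_eq_sum Φ (Matrix.of fun i i' => X (i, j) (i', j')) a b
    rw [tensorMap_id_right_apply]
    simp only [Matrix.of_apply] at hb
    rw [← hb, hΦ]
    simp only [Matrix.sum_apply, Matrix.mul_apply, conjTranspose_apply, kroneckerMap_apply,
      Matrix.of_apply, Fintype.sum_prod_type, Matrix.one_apply, mul_ite, mul_one, mul_zero,
      ite_mul, zero_mul, Finset.sum_ite_eq, Finset.mem_univ, if_true, apply_ite star, star_zero]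
  rw [h]
  exact Matrix.posSemidef_sum _ fun m _ => hX.mul_mul_conjTranspose_same _

theorem IsComplementary.isCPTP [Fintype ι] [DecidableEq ι] [Fintype κ] [Fintype κ']
    {N : SuperOp ι κ} {Nc : SuperOp ι κ'} (h : IsComplementary N Nc) :
    IsCPTP N ∧ IsCPTP Nc := by
  obtain ⟨V, hV, hN⟩ := h
  have htr : ∀ X : Matrix ι ι ℂ, (V * X * Vᴴ).trace = X.trace := fun X => by
    rw [Matrix.trace_mul_comm, ← Matrix.mul_assoc, hV, Matrix.one_mul]
  refine ⟨⟨isCP_of_kraus N (fun m : κ' => Matrix.of fun k i => V (k, m) i) fun X => ?_,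
    fun X => ?_⟩, ⟨isCP_of_kraus Nc (fun m : κ => Matrix.of fun k i => V (m, k) i) fun X => ?_,
    fun X => ?_⟩⟩
  · rw [(hN X).1]
    ext a b
    simp [traceSnd, Matrix.mul_apply, Matrix.sum_apply]
  · rw [(hN X).1, ← htr X]
    simp [traceSnd, Matrix.trace, Fintype.sum_prod_type]
  · rw [(hN X).2]
    ext a b
    simp [traceFst, Matrix.mul_apply, Matrix.sum_apply]
  · rw [(hN X).2, ← htr X]
    simp only [traceFst, Matrix.trace, Fintype.sum_prod_type, Matrix.diag_apply, Matrix.of_apply]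
    exact Finset.sum_comm

/-! ### Gram matrices of matrix units and complementary channels. -/

/-- The Gram matrix of the images of the matrix units under a map with `N† N = a id + b Tr[·] I`. -/
theorem AdjointSquare.trace_single [Fintype ι] [DecidableEq ι] [Fintype κ] {N : SuperOp ι κ}
    {a b : ℝ} (h : AdjointSquare N a b) (i j k l : ι) :
    ((N (single i j 1))ᴴ * N (single k l 1)).trace =
      (a : ℂ) * (if i = k ∧ j = l then 1 else 0) + (b : ℂ) * (if i = j ∧ k = l then 1 else 0) := by
  have := congrFun (congrFun (h.2.2 (single k l 1)) i) j
  simp only [LinearMap.comp_apply, hsAdjoint, LinearMap.coe_mk, AddHom.coe_mk, Matrix.of_apply]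
    at this
  rw [this]
  simp only [Matrix.add_apply, Matrix.smul_apply, smul_eq_mul, Matrix.one_apply, single,
    Matrix.of_apply, Matrix.trace, Matrix.diag_apply]
  congr 2
  · simp only [eq_comm]
  · by_cases hkl : k = l
    · subst hkl; simp
    · have : ∀ x, ¬ (k = x ∧ l = x) := by rintro x ⟨rfl, h⟩; exact hkl h.symm
      simp [this, hkl]

theorem AdjointSquare.of_trace_single [Fintype ι] [DecidableEq ι] [Fintype κ] {N : SuperOp ι κ}
    {a b : ℝ} (ha : 0 ≤ a) (hb : 0 ≤ b)
    (h : ∀ i j k l, ((N (single i j 1))ᴴ * N (single k l 1)).trace =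
      (a : ℂ) * (if i = k ∧ j = l then 1 else 0) + (b : ℂ) * (if i = j ∧ k = l then 1 else 0)) :
    AdjointSquare N a b := by
  refine ⟨ha, hb, fun X => ?_⟩
  ext i j
  rw [map_apply_eq_sum]
  simp only [LinearMap.comp_apply, hsAdjoint, LinearMap.coe_mk, AddHom.coe_mk, Matrix.of_apply, h]
  simp only [mul_add, Finset.sum_add_distrib, Matrix.add_apply, Matrix.smul_apply, smul_eq_mul,
    Matrix.one_apply, Matrix.trace, Matrix.diag_apply]
  congr 1
  · simp [ite_and, mul_comm]
  · by_cases hij : i = j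
    · simp [hij, mul_comm, Finset.mul_sum]
    · simp [hij]

/-- Passing to a complementary channel interchanges the two coefficients of `N† N`. -/
theorem IsComplementary.adjointSquare [Fintype ι] [DecidableEq ι] [Fintype κ] [Fintype κ']
    {N : SuperOp ι κ} {Nc : SuperOp ι κ'} (h : IsComplementary N Nc) {a b : ℝ}
    (hN : AdjointSquare N a b) : AdjointSquare Nc b a := by
  refine AdjointSquare.of_trace_single hN.2.1 hN.1 fun i j k l => ?_
  have h1 := hN.trace_single l j k i
  obtain ⟨V, -, hV⟩ := h
  have hs : ∀ i j x y, (V * single i j (1 : ℂ) * Vᴴ) x y = V x i * star (V y j) := by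
    intro i j x y
    simp [Matrix.mul_apply, single, ite_and, Finset.sum_ite_eq]
  -- Both sides contract the same four copies of `V`. Tracing out the other factor interchanges `i`
  -- and `l`, hence the two Kronecker patterns.
  have e1 : ((Nc (single i j 1))ᴴ * Nc (single k l 1)).trace =
      ((N (single l j 1))ᴴ * N (single k i 1)).trace := by
    simp only [(hV _).1, (hV _).2, Matrix.trace, Matrix.diag_apply, Matrix.mul_apply,
      conjTranspose_apply, traceFst, traceSnd, Matrix.of_apply, hs, star_sum, star_mul', star_star,
      Finset.sum_mul_sum]
    rw [sum_sum_comm_sum_sum]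
    refine Finset.sum_congr rfl fun m _ => Finset.sum_congr rfl fun m' _ =>
      Finset.sum_congr rfl fun x _ => Finset.sum_congr rfl fun y _ => ?_
    ring
  rw [e1, h1, add_comm]
  simp only [eq_comm, and_comm]

/-- The map `X ↦ S (X ⊗ I) S†` is complementary to the trace preserving map `N` whose Choi matrix
is, up to a permutation of the indices, `S† S`. -/
theorem isComplementary_conjAmp {d : ℕ} {N : SuperOp (Fin d) (Fin d)}
    {S : Matrix (Fin d × Fin d) (Fin d × Fin d) ℂ} (htr : ∀ X, (N X).trace = X.trace)
    (hN : ∀ X j j', N X j j' = ∑ i, ∑ i', X i i' * (Sᴴ * S) (i', j') (i, j)) :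
    IsComplementary N (conjAmp d S) := by
  -- `V|i⟩ = ∑ⱼ |j⟩ ⊗ S|i,j⟩`. The entries of `Vᴴ V` are the traces of `N` on matrix units, so being
  -- an isometry is trace preservation.
  refine ⟨Matrix.of fun x i => S x.2 (i, x.1), ?_, fun X => ⟨?_, ?_⟩⟩
  · ext i' i
    have h := htr (single i i' 1)
    simp only [Matrix.trace, Matrix.diag_apply, hN] at h
    have h2 : ∀ j, ∑ x, ∑ x', single i i' (1 : ℂ) x x' * (Sᴴ * S) (x', j) (x, j) =
        (Sᴴ * S) (i', j) (i, j) := fun j => by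
      simp [single, ite_and, Finset.sum_ite_eq]
    simp only [h2] at h
    have h3 : ∑ x, single i i' (1 : ℂ) x x = (1 : Matrix (Fin d) (Fin d) ℂ) i' i := by
      simp [single, ite_and, Matrix.one_apply]
    rw [← h3, ← h]
    simp only [Matrix.mul_apply, conjTranspose_apply, Matrix.of_apply, Fintype.sum_prod_type]
  · ext j j'
    rw [hN]
    simp only [traceSnd, Matrix.mul_apply, conjTranspose_apply, Matrix.of_apply, Finset.sum_mul,
      Finset.mul_sum]
    rw [Finset.sum_comm]
    conv_rhs => rw [Finset.sum_comm]; enter [2, x]; rw [Finset.sum_comm]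
    refine Finset.sum_congr rfl fun x _ => Finset.sum_congr rfl fun y _ =>
      Finset.sum_congr rfl fun z _ => ?_
    ring
  · ext z w
    simp only [conjAmp, LinearMap.coe_mk, AddHom.coe_mk, traceFst, Matrix.mul_apply,
      conjTranspose_apply, Matrix.of_apply, Fintype.sum_prod_type, kroneckerMap_apply,
      Matrix.one_apply, mul_ite, mul_one, mul_zero, Finset.sum_ite_eq', Finset.mem_univ,
      if_true]
    rw [Finset.sum_comm]

/-! ### The depolarizing and transpose-depolarizing channels. -/

theorem depol_trace {d : ℕ} (hd : d ≠ 0) (p : ℝ) (X : Matrix (Fin d) (Fin d) ℂ) :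
    (depol d p X).trace = X.trace := by
  have : (d : ℂ) ≠ 0 := by exact_mod_cast hd
  simp [depol]
  field_simp
  ring

theorem transDepol_trace {d : ℕ} (hd : d ≠ 0) (t : ℝ) (X : Matrix (Fin d) (Fin d) ℂ) :
    (transDepol d t X).trace = X.trace := by
  have : (d : ℂ) ≠ 0 := by exact_mod_cast hd
  simp [transDepol]
  field_simp
  ring

theorem trace_single_one [Fintype ι] [DecidableEq ι] (i j : ι) :
    (single i j (1 : ℂ)).trace = if i = j then 1 else 0 := by
  by_cases h : i = j
  · subst h; simp
  · simp [h]

theorem depol_adjointSquare {d : ℕ} (hd : d ≠ 0) {p : ℝ} (hp : 0 ≤ p) (hp2 : p ≤ 2) :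
    AdjointSquare (depol d p) ((1 - p) ^ 2) (p * (2 - p) / d) := by
  refine ⟨sq_nonneg _, div_nonneg (mul_nonneg hp (by linarith)) (by positivity), fun X => ?_⟩
  ext i j
  simp only [LinearMap.comp_apply, hsAdjoint, LinearMap.coe_mk, AddHom.coe_mk, Matrix.of_apply]
  have h1 : (depol d p (single i j 1))ᴴ = ((1 - p : ℝ) : ℂ) • single j i 1 +
      ((p / d : ℝ) : ℂ) • (if i = j then (1 : ℂ) else 0) • 1 := by
    simp only [depol, LinearMap.coe_mk, AddHom.coe_mk, trace_single_one]
    split_ifs <;> simp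
  rw [h1, Matrix.add_mul, Matrix.trace_add]
  simp only [Matrix.smul_mul, trace_smul, Matrix.one_mul, depol_trace hd, trace_single_mul]
  simp only [depol, LinearMap.coe_mk, AddHom.coe_mk, Matrix.add_apply, Matrix.smul_apply,
    smul_eq_mul, Matrix.one_apply]
  push_cast
  ring

theorem transDepol_adjointSquare {d : ℕ} (hd : d ≠ 0) {t : ℝ} (ht : t ^ 2 ≤ 1) :
    AdjointSquare (transDepol d t) (t ^ 2) ((1 - t ^ 2) / d) := by
  refine ⟨sq_nonneg _, div_nonneg (by linarith) (by positivity), fun X => ?_⟩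
  ext i j
  simp only [LinearMap.comp_apply, hsAdjoint, LinearMap.coe_mk, AddHom.coe_mk, Matrix.of_apply]
  have h1 : (transDepol d t (single i j 1))ᴴ = (t : ℂ) • single i j 1 +
      (((1 - t) / d : ℝ) : ℂ) • (if i = j then (1 : ℂ) else 0) • 1 := by
    simp only [transDepol, LinearMap.coe_mk, AddHom.coe_mk, trace_single_one]
    split_ifs <;> simp
  rw [h1, Matrix.add_mul, Matrix.trace_add]
  simp only [Matrix.smul_mul, trace_smul, Matrix.one_mul, transDepol_trace hd, trace_single_mul]
  simp only [transDepol, LinearMap.coe_mk, AddHom.coe_mk, Matrix.add_apply, Matrix.smul_apply,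
    smul_eq_mul, Matrix.one_apply, Matrix.transpose_apply, eq_comm (a := j)]
  push_cast
  ring

theorem flipOp_mul_self (d : ℕ) : flipOp d * flipOp d = 1 := by
  ext x y
  simp only [flipOp, Matrix.mul_apply, Matrix.of_apply, Matrix.one_apply, ite_mul, one_mul,
    zero_mul]
  rw [Finset.sum_eq_single x.swap] <;> aesop

theorem flipOp_conjTranspose (d : ℕ) : (flipOp d)ᴴ = flipOp d := by
  ext x y
  simp only [flipOp, conjTranspose_apply, Matrix.of_apply, apply_ite star, star_one, star_zero]
  congr 1
  aesop

theorem maxEnt_apply (ι : Type*) [Fintype ι] [DecidableEq ι] (i j i' j' : ι) :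
    maxEnt ι (i, j) (i', j') =
      (Fintype.card ι : ℂ)⁻¹ * (if i = j then 1 else 0) * (if i' = j' then 1 else 0) := by
  have : (((Real.sqrt (Fintype.card ι))⁻¹ : ℝ) : ℂ) * (((Real.sqrt (Fintype.card ι))⁻¹ : ℝ) : ℂ) =
      (Fintype.card ι : ℂ)⁻¹ := by
    rw [← Complex.ofReal_mul, ← mul_inv, Real.mul_self_sqrt (by positivity)]
    simp
  simp only [maxEnt, maxEntVec, vecMulVec_apply, Pi.star_apply, apply_ite star, star_zero]
  split_ifs <;> simp [← this]

theorem maxEnt_conjTranspose (ι : Type*) [Fintype ι] [DecidableEq ι] : (maxEnt ι)ᴴ = maxEnt ι := by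
  simp [maxEnt, conjTranspose_vecMulVec]

theorem maxEnt_mul_self (ι : Type*) [Fintype ι] [DecidableEq ι] [Nonempty ι] :
    maxEnt ι * maxEnt ι = maxEnt ι := by
  ext ⟨i, j⟩ ⟨i', j'⟩
  simp only [Matrix.mul_apply, Fintype.sum_prod_type, maxEnt_apply]
  have : (Fintype.card ι : ℂ) ≠ 0 := Nat.cast_ne_zero.2 Fintype.card_ne_zero
  simp [Finset.sum_ite_eq]

theorem opS_conjTranspose_mul_self {d : ℕ} (hd : d ≠ 0) {t : ℝ}
    (h1 : 0 ≤ 1 + ((d : ℝ) - 1) * t) (h2 : 0 ≤ 1 - ((d : ℝ) + 1) * t) :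
    (opS d t)ᴴ * opS d t = (((1 - t) / d : ℝ) : ℂ) • 1 + (t : ℂ) • flipOp d := by
  unfold opS
  have e1 := Real.mul_self_sqrt (div_nonneg h1 (by positivity : (0 : ℝ) ≤ 4 * d))
  have e2 := Real.mul_self_sqrt (div_nonneg h2 (by positivity : (0 : ℝ) ≤ 4 * d))
  generalize Real.sqrt ((1 + ((d : ℝ) - 1) * t) / (4 * d)) = x at *
  generalize Real.sqrt ((1 - ((d : ℝ) + 1) * t) / (4 * d)) = y at *
  have hd' : (d : ℝ) ≠ 0 := by exact_mod_cast hd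
  -- The flip is a self-adjoint involution, so `(αI + βΠ)² = (α² + β²)I + 2αβΠ`, here with `α = x +
  -- y` and `β = x - y`.
  have e3 : (1 - t) / d = (x + y) * (x + y) + (x - y) * (x - y) := by
    rw [show (x + y) * (x + y) + (x - y) * (x - y) = 2 * (x * x) + 2 * (y * y) by ring, e1, e2]
    field_simp; ring
  have e4 : t = 2 * ((x + y) * (x - y)) := by
    rw [show (x + y) * (x - y) = x * x - y * y by ring, e1, e2]
    field_simp; ring
  rw [e3]
  conv_rhs => rw [e4]
  simp only [conjTranspose_add, conjTranspose_smul, conjTranspose_one, flipOp_conjTranspose,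
    Matrix.add_mul, Matrix.mul_add, Matrix.smul_mul, Matrix.mul_smul, Matrix.one_mul,
    Matrix.mul_one, flipOp_mul_self, Complex.star_def, Complex.conj_ofReal]
  push_cast
  module

theorem opP_conjTranspose_mul_self {d : ℕ} (hd : d ≠ 0) {p : ℝ} (hp : 0 ≤ p)
    (h : 0 ≤ 1 - p * (((d : ℝ) ^ 2 - 1) / (d : ℝ) ^ 2)) :
    (opP d p)ᴴ * opP d p = ((p / d : ℝ) : ℂ) • 1 + ((d * (1 - p) : ℝ) : ℂ) • maxEnt (Fin d) := by
  have : Nonempty (Fin d) := ⟨⟨0, Nat.pos_of_ne_zero hd⟩⟩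
  have hd' : (d : ℝ) ≠ 0 := by exact_mod_cast hd
  unfold opP
  rw [Real.sqrt_div hp]
  have e0 := Real.mul_self_sqrt (Nat.cast_nonneg (α := ℝ) d)
  have hs : Real.sqrt d ≠ 0 := Real.sqrt_ne_zero'.2 (by positivity)
  have e1 := Real.mul_self_sqrt hp
  have e2 := Real.mul_self_sqrt h
  generalize Real.sqrt (1 - p * (((d : ℝ) ^ 2 - 1) / (d : ℝ) ^ 2)) = y at *
  generalize Real.sqrt p = x at *
  generalize Real.sqrt d = r at *
  have e3 : p / d = (x / r) * (x / r) := by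
    rw [div_mul_div_comm, e1, e0]
  -- For a projection `Q`, `(αI + βQ)² = α²I + (2αβ + β²)Q`; this is the second coefficient.
  have e4 : d * (1 - p) = 2 * ((x / r) * (r * (-(x / d) + y))) +
      (r * (-(x / d) + y)) * (r * (-(x / d) + y)) := by
    have : 2 * ((x / r) * (r * (-(x / d) + y))) +
      (r * (-(x / d) + y)) * (r * (-(x / d) + y)) =
        - 2 * (x * x) / d + 2 * x * y + (r * r) * ((x * x) / d ^ 2 - 2 * x * y / d + y * y) := by
      field_simp; ring
    rw [this, e0, e1, e2]
    field_simp; ring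
  rw [e3, e4]
  simp only [conjTranspose_add, conjTranspose_smul, conjTranspose_one, maxEnt_conjTranspose,
    Matrix.add_mul, Matrix.mul_add, Matrix.smul_mul, Matrix.mul_smul, Matrix.one_mul,
    Matrix.mul_one, maxEnt_mul_self, Complex.star_def, Complex.conj_ofReal]
  push_cast
  module

theorem transDepol_isComplementary {d : ℕ} (hd : d ≠ 0) {t : ℝ}
    (h1 : 0 ≤ 1 + ((d : ℝ) - 1) * t) (h2 : 0 ≤ 1 - ((d : ℝ) + 1) * t) :
    IsComplementary (transDepol d t) (transDepolCompl d t) := by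
  refine isComplementary_conjAmp (transDepol_trace hd t) fun X j j' => ?_
  rw [opS_conjTranspose_mul_self hd h1 h2]
  simp only [transDepol, LinearMap.coe_mk, AddHom.coe_mk, Matrix.add_apply, Matrix.smul_apply,
    smul_eq_mul, Matrix.one_apply, flipOp, Matrix.of_apply, Prod.swap_prod_mk, Prod.mk.injEq,
    Matrix.transpose_apply, mul_add, Finset.sum_add_distrib, Matrix.trace, Matrix.diag_apply]
  rw [add_comm]
  congr 1
  · by_cases h : j = j' <;> simp [h, Ne.symm, eq_comm, Finset.mul_sum, mul_comm]
  · simp [ite_and, mul_comm]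

theorem depol_isComplementary {d : ℕ} (hd : d ≠ 0) {p : ℝ} (hp : 0 ≤ p)
    (h : 0 ≤ 1 - p * (((d : ℝ) ^ 2 - 1) / (d : ℝ) ^ 2)) :
    IsComplementary (depol d p) (depolCompl d p) := by
  have hd' : (d : ℂ) ≠ 0 := by exact_mod_cast hd
  refine isComplementary_conjAmp (depol_trace hd p) fun X j j' => ?_
  rw [opP_conjTranspose_mul_self hd hp h]
  simp only [depol, LinearMap.coe_mk, AddHom.coe_mk, Matrix.add_apply, Matrix.smul_apply,
    smul_eq_mul, Matrix.one_apply, maxEnt_apply, Prod.mk.injEq,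
    mul_add, Finset.sum_add_distrib, Matrix.trace, Matrix.diag_apply]
  rw [add_comm]
  congr 1
  · by_cases h : j = j' <;> simp [h, eq_comm, Finset.mul_sum, mul_comm]
  · simp [mul_comm, hd']

/-! ### Purity inequalities from partial swaps on two copies of a pure state. -/

/-- Averaging a vector over a group of commuting involutions twisted by a real character gives
a nonnegative quadratic form. -/
theorem sum_character_mul_nonneg {H Z : Type*} [Fintype H] [Fintype Z]
    (op : H → H → H) (hop : ∀ h, Function.Bijective fun g => op g h)
    (π : H → Z → Z) (hinv : ∀ h, Function.Involutive (π h))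
    (hπ : ∀ g h z, π g (π h z) = π (op g h) z)
    (χ : H → ℝ) (hχ : ∀ g h, χ (op g h) = χ g * χ h) (Ψ : Z → ℂ) :
    0 ≤ ∑ h, (χ h : ℂ) * ∑ z, star (Ψ z) * Ψ (π h z) := by
  -- The squared norm of the twisted sum of translates: each `π h` is a self-adjoint permutation, so
  -- every fixed `h` contributes the same sum over the group.
  have key : ∑ z, star (∑ h, (χ h : ℂ) * Ψ (π h z)) * (∑ h, (χ h : ℂ) * Ψ (π h z)) =
      Fintype.card H * ∑ h, (χ h : ℂ) * ∑ z, star (Ψ z) * Ψ (π h z) := by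
    have h1 : ∀ h, ∑ g, ∑ z, star ((χ h : ℂ) * Ψ (π h z)) * ((χ g : ℂ) * Ψ (π g z)) =
        ∑ h, (χ h : ℂ) * ∑ z, star (Ψ z) * Ψ (π h z) := by
      intro h
      conv_rhs => rw [← (hop h).sum_comp]
      refine Finset.sum_congr rfl fun g _ => ?_
      rw [← (hinv h).bijective.sum_comp, Finset.mul_sum]
      refine Finset.sum_congr rfl fun z _ => ?_
      rw [hinv h z, hπ, hχ, star_mul']
      simp
      ring
    simp only [star_sum, Finset.sum_mul_sum]
    rw [Finset.sum_comm]
    simp only [fun h => Finset.sum_comm (s := Finset.univ) (t := Finset.univ)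
      (f := fun z g => star ((χ h : ℂ) * Ψ (π h z)) * ((χ g : ℂ) * Ψ (π g z))), h1]
    simp
  by_cases hH : Fintype.card H = 0
  · have := Fintype.card_eq_zero_iff.1 hH
    simp
  · have hpos : (0 : ℂ) ≤ (Fintype.card H : ℂ)⁻¹ := by
      rw [← Complex.ofReal_natCast, ← Complex.ofReal_inv]
      exact_mod_cast inv_nonneg.2 (Nat.cast_nonneg (α := ℝ) _)
    rw [← inv_mul_cancel_left₀ (Nat.cast_ne_zero.2 hH : (Fintype.card H : ℂ) ≠ 0)
      (∑ h, _), ← key]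
    exact mul_nonneg hpos (Finset.sum_nonneg fun z _ => star_mul_self_nonneg _)

/-- `swapOn s x y` is the first component of the pair `(x, y)` after exchanging the coordinates
marked by `s`. -/
def swapOn {n : ℕ} (s : Fin n → Bool) (x y : Fin n → ι) : Fin n → ι :=
  fun k => cond (s k) (y k) (x k)

/-- The expectation in `ψ ⊗ ψ` of the operator exchanging the two copies of the systems marked by
`s`, `u` and `v`. -/
def swapExp {n : ℕ} [Fintype ι] [Fintype κ] [Fintype κ']
    (ψ : (Fin n → ι) → κ → κ' → ℂ) (s : Fin n → Bool) (u v : Bool) : ℂ :=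
  ∑ z : ((Fin n → ι) × (Fin n → ι)) × (κ × κ) × (κ' × κ'),
    star (ψ z.1.1 z.2.1.1 z.2.2.1 * ψ z.1.2 z.2.1.2 z.2.2.2) *
      (ψ (swapOn s z.1.1 z.1.2) (cond u z.2.1.2 z.2.1.1) (cond v z.2.2.2 z.2.2.1) *
       ψ (swapOn s z.1.2 z.1.1) (cond u z.2.1.1 z.2.1.2) (cond v z.2.2.1 z.2.2.2))

theorem swapOn_not {n : ℕ} (s : Fin n → Bool) (x y : Fin n → ι) :
    swapOn (fun k => !s k) x y = swapOn s y x := by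
  ext k; cases h : s k <;> simp [swapOn, h]

/-- The total swap fixes ψ ⊗ ψ: complementary marginals of a pure state have equal purity. -/
theorem swapExp_not {n : ℕ} [Fintype ι] [Fintype κ] [Fintype κ']
    (ψ : (Fin n → ι) → κ → κ' → ℂ) (s : Fin n → Bool) (u v : Bool) :
    swapExp ψ (fun k => !s k) (!u) (!v) = swapExp ψ s u v := by
  refine Finset.sum_congr rfl fun z _ => ?_
  rw [swapOn_not, swapOn_not, mul_comm (ψ (swapOn s z.1.2 z.1.1) _ _)]
  cases u <;> cases v <;> rfl

theorem swapExp_comm {n : ℕ} [Fintype ι] [Fintype κ] [Fintype κ']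
    (ψ : (Fin n → ι) → κ → κ' → ℂ) (s : Fin n → Bool) (u v : Bool) :
    swapExp (fun g r e => ψ g e r) s u v = swapExp ψ s v u := by
  unfold swapExp
  rw [← ((Equiv.refl _).prodCongr (Equiv.prodComm (κ × κ) (κ' × κ'))).sum_comp]
  rfl

/-- The sign `(-1)^(f ∧ s)`. -/
def boolSign (f s : Bool) : ℝ := if f && s then -1 else 1

theorem boolSign_xor (f s t : Bool) : boolSign f (xor s t) = boolSign f s * boolSign f t := by
  cases f <;> cases s <;> cases t <;> simp [boolSign]

/-- Up to a positive factor this is the squared norm of the projection of ψ ⊗ ψ that antisymmetrizes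
the pairs with sign bit `true` and symmetrizes the others. -/
theorem sum_boolSign_mul_swapExp_nonneg {n : ℕ} [Fintype ι] [Fintype κ] [Fintype κ']
    (ψ : (Fin n → ι) → κ → κ' → ℂ) (f : Fin n → Bool) (p q : Bool) :
    0 ≤ ∑ s, ∑ u, ∑ v, ((∏ k, boolSign (f k) (s k)) * boolSign p u * boolSign q v) *
      (swapExp ψ s u v).re := by
  have h := sum_character_mul_nonneg
    (H := (Fin n → Bool) × Bool × Bool)
    (Z := ((Fin n → ι) × (Fin n → ι)) × (κ × κ) × (κ' × κ'))
    (op := fun g h => (fun k => xor (g.1 k) (h.1 k), xor g.2.1 h.2.1, xor g.2.2 h.2.2))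
    (hop := fun h => Function.Involutive.bijective fun g => by ext <;> simp)
    (π := fun h z => ((swapOn h.1 z.1.1 z.1.2, swapOn h.1 z.1.2 z.1.1),
      (cond h.2.1 z.2.1.2 z.2.1.1, cond h.2.1 z.2.1.1 z.2.1.2),
      (cond h.2.2 z.2.2.2 z.2.2.1, cond h.2.2 z.2.2.1 z.2.2.2)))
    (hinv := by
      rintro ⟨s, u, v⟩ ⟨⟨x, x'⟩, ⟨y, y'⟩, ⟨z, z'⟩⟩
      have h1 : ∀ x x' : Fin n → ι, swapOn s (swapOn s x x') (swapOn s x' x) = x := by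
        intro x x'; ext k; cases h : s k <;> simp [swapOn, h]
      simp only [h1]
      cases u <;> cases v <;> rfl)
    (hπ := by
      rintro ⟨s, u, v⟩ ⟨s', u', v'⟩ ⟨⟨x, x'⟩, ⟨y, y'⟩, ⟨z, z'⟩⟩
      have h1 : ∀ x x' : Fin n → ι, swapOn s (swapOn s' x x') (swapOn s' x' x) =
          swapOn (fun k => xor (s k) (s' k)) x x' := by
        intro x x'; ext k; cases h : s k <;> cases h' : s' k <;> simp [swapOn, h, h']
      simp only [h1]
      cases u <;> cases v <;> cases u' <;> cases v' <;> rfl)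
    (χ := fun h => (∏ k, boolSign (f k) (h.1 k)) * boolSign p h.2.1 * boolSign q h.2.2)
    (hχ := by
      rintro ⟨s, u, v⟩ ⟨s', u', v'⟩
      simp only [boolSign_xor, Finset.prod_mul_distrib]
      ring)
    (Ψ := fun z => ψ z.1.1 z.2.1.1 z.2.2.1 * ψ z.1.2 z.2.1.2 z.2.2.2)
  have h2 := (Complex.le_def.1 h).1
  simp only [Complex.zero_re, Complex.re_sum, Complex.re_ofReal_mul, Fintype.sum_prod_type] at h2
  convert h2 using 6
  simp only [swapExp, Fintype.sum_prod_type, Complex.re_sum]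

/-- The weight `∏ₖ (a if s k else b)`. -/
def boolWeight {n : ℕ} (a b : ℝ) (s : Fin n → Bool) : ℝ := ∏ k, cond (s k) a b

theorem boolWeight_not {n : ℕ} (a b : ℝ) (s : Fin n → Bool) :
    boolWeight a b (fun k => !s k) = boolWeight b a s :=
  Finset.prod_congr rfl fun k _ => by cases h : s k <;> simp [h]

/-- Walsh transform of a product function, taken factor by factor: it converts coefficients on
isotypic components into weights on partial swaps. -/
theorem sum_prod_mul_boolSign {n : ℕ} (a b : ℝ) (s : Fin n → Bool) :
    ∑ f : Fin n → Bool, (∏ k, (a + b * boolSign (f k) true)) * ∏ k, boolSign (f k) (s k) =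
      2 ^ n * boolWeight b a s := by
  simp only [← Finset.prod_mul_distrib]
  rw [← Fintype.prod_sum (fun k x => (a + b * boolSign x true) * boolSign x (s k)), boolWeight,
    ← Fin.prod_const n (2 : ℝ), ← Finset.prod_mul_distrib]
  refine Finset.prod_congr rfl fun k _ => ?_
  cases s k <;> simp [boolSign] <;> ring

/-- For sign `+1` both factors are `a + b`; for sign `-1` they are `|b - a|` and `a - b`, which is
where `b ≤ a` enters. -/
theorem abs_prod_boolSign_le {n : ℕ} {a b : ℝ} (hb : 0 ≤ b) (hab : b ≤ a) (f : Fin n → Bool) :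
    |∏ k, (b + a * boolSign (f k) true)| ≤ ∏ k, (a + b * boolSign (f k) true) := by
  rw [Finset.abs_prod]
  refine Finset.prod_le_prod (fun _ _ => abs_nonneg _) fun k _ => ?_
  cases f k <;> simp only [boolSign, Bool.and_true, if_true, if_false, Bool.false_eq_true] <;>
    rw [abs_le] <;> constructor <;> linarith

/-- For `b ≤ a` the weighted sum of the purities of the marginals containing `κ` is at most
the weighted sum of the purities of the complementary marginals of the first systems. -/
theorem sum_boolWeight_swapExp_le {n : ℕ} [Fintype ι] [Fintype κ] [Fintype κ']
    (ψ : (Fin n → ι) → κ → κ' → ℂ) {a b : ℝ} (hb : 0 ≤ b) (hab : b ≤ a) :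
    ∑ s, boolWeight a b s * (swapExp ψ s true false).re ≤
      ∑ s, boolWeight b a s * (swapExp ψ s false false).re := by
  -- Only components antisymmetric in `κ'` are used, with both symmetry types in `κ`. Summing over
  -- `f` and `p` leaves the `b, a`-weighted P(S) − P(SR) minus the `a, b`-weighted P(SE) − P(SER),
  -- where P is purity, E is `κ` and R is `κ'`.
  have h0 : 0 ≤ ∑ f : Fin n → Bool, ∑ p : Bool,
      ((∏ k, (a + b * boolSign (f k) true)) -
        boolSign p true * ∏ k, (b + a * boolSign (f k) true)) *
      ∑ s, ∑ u, ∑ v, ((∏ k, boolSign (f k) (s k)) * boolSign p u * boolSign true v) *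
        (swapExp ψ s u v).re := by
    refine Finset.sum_nonneg fun f _ => Finset.sum_nonneg fun p _ =>
      mul_nonneg ?_ (sum_boolSign_mul_swapExp_nonneg ψ f p true)
    have := abs_le.1 (abs_prod_boolSign_le hb hab f)
    cases p <;> simp [boolSign] at this ⊢ <;> linarith [this.1, this.2]
  have h1 : ∀ f : Fin n → Bool, ∑ p : Bool,
      ((∏ k, (a + b * boolSign (f k) true)) -
        boolSign p true * ∏ k, (b + a * boolSign (f k) true)) *
      ∑ s, ∑ u, ∑ v, ((∏ k, boolSign (f k) (s k)) * boolSign p u * boolSign true v) *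
        (swapExp ψ s u v).re =
      ∑ s, (2 * ((∏ k, (a + b * boolSign (f k) true)) * ∏ k, boolSign (f k) (s k)) *
          ((swapExp ψ s false false).re - (swapExp ψ s false true).re) -
        2 * ((∏ k, (b + a * boolSign (f k) true)) * ∏ k, boolSign (f k) (s k)) *
          ((swapExp ψ s true false).re - (swapExp ψ s true true).re)) := by
    intro f
    simp only [Fintype.sum_bool, Finset.mul_sum, ← Finset.sum_add_distrib]
    refine Finset.sum_congr rfl fun s _ => ?_
    simp only [boolSign, Bool.and_true, Bool.and_false, if_true, if_false,
      Bool.false_eq_true]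
    ring
  simp only [h1] at h0
  rw [Finset.sum_comm] at h0
  simp only [Finset.sum_sub_distrib, ← Finset.sum_mul, ← Finset.mul_sum,
    sum_prod_mul_boolSign] at h0
  have hnot : Function.Bijective fun s : Fin n → Bool => fun k => !s k :=
    Function.Involutive.bijective fun s => by ext; simp
  -- Complementation identifies SR with SᶜE and SER with Sᶜ while exchanging the weights, so each
  -- half repeats the desired gap. The factors come from the sum over `p`, the Walsh transform and
  -- this doubling.
  have h2 : ∑ s : Fin n → Bool, 2 * (2 ^ n * boolWeight b a s) *
        ((swapExp ψ s false false).re - (swapExp ψ s false true).re) -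
      ∑ s : Fin n → Bool, 2 * (2 ^ n * boolWeight a b s) *
        ((swapExp ψ s true false).re - (swapExp ψ s true true).re) =
      2 * 2 ^ n * 2 * (∑ s, boolWeight b a s * (swapExp ψ s false false).re -
        ∑ s, boolWeight a b s * (swapExp ψ s true false).re) := by
    have e1 : ∑ s, boolWeight b a s * (swapExp ψ s false true).re =
        ∑ s, boolWeight a b s * (swapExp ψ s true false).re := by
      rw [← hnot.sum_comp]
      refine Finset.sum_congr rfl fun s _ => ?_
      rw [boolWeight_not, ← swapExp_not ψ s true false]; rfl
    have e2 : ∑ s, boolWeight a b s * (swapExp ψ s true true).re =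
        ∑ s, boolWeight b a s * (swapExp ψ s false false).re := by
      rw [← hnot.sum_comp]
      refine Finset.sum_congr rfl fun s _ => ?_
      rw [boolWeight_not, ← swapExp_not ψ s false false]; rfl
    have e3 : ∀ (w x y : (Fin n → Bool) → ℝ), ∑ s, 2 * (2 ^ n * w s) * (x s - y s) =
        2 * 2 ^ n * (∑ s, w s * x s - ∑ s, w s * y s) := by
      intro w x y
      rw [← Finset.sum_sub_distrib, Finset.mul_sum]
      exact Finset.sum_congr rfl fun s _ => by ring
    rw [e3, e3, e1, e2]
    ring
  rw [h2] at h0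
  have := (mul_nonneg_iff_of_pos_left (by positivity : (0 : ℝ) < 2 * 2 ^ n * 2)).1 h0
  linarith

/-- The previous bound with `κ, κ'` and `a, b` exchanged; complementation then turns the marginals
with `κ'` back into marginals with `κ`. -/
theorem sum_boolWeight_swapExp_le' {n : ℕ} [Fintype ι] [Fintype κ] [Fintype κ']
    (ψ : (Fin n → ι) → κ → κ' → ℂ) {a b : ℝ} (ha : 0 ≤ a) (hab : a ≤ b) :
    ∑ s, boolWeight a b s * (swapExp ψ s true false).re ≤
      ∑ s, boolWeight a b s * (swapExp ψ s false false).re := by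
  have h := sum_boolWeight_swapExp_le (fun g r e => ψ g e r) ha hab
  simp only [swapExp_comm] at h
  have hnot : Function.Bijective fun s : Fin n → Bool => fun k => !s k :=
    Function.Involutive.bijective fun s => by ext; simp
  refine le_of_eq_of_le ?_ h
  rw [← hnot.sum_comp]
  refine Finset.sum_congr rfl fun s _ => ?_
  rw [boolWeight_not, ← swapExp_not ψ s false true]; rfl

/-! ### Output purity as a weighted sum of marginal purities. -/

theorem sum_sum_prod {n : ℕ} {α β R : Type*} [Fintype α] [Fintype β] [CommSemiring R]
    (f : Fin n → α → β → R) :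
    ∑ x : Fin n → α, ∑ y : Fin n → β, ∏ k, f k (x k) (y k) = ∏ k, ∑ i, ∑ j, f k i j := by
  classical
  have h : ∀ x : Fin n → α, ∑ y : Fin n → β, ∏ k, f k (x k) (y k) = ∏ k, ∑ j, f k (x k) j :=
    fun x => (Fintype.prod_sum fun k j => f k (x k) j).symm
  simp only [h]
  exact (Fintype.prod_sum fun k i => ∑ j, f k i j).symm

theorem IsCP.posSemidef_choi [Fintype ι] [DecidableEq ι] [Fintype κ] {Λ : SuperOp ι κ}
    (h : IsCP Λ) :
    (Matrix.of fun x y : ι × κ => Λ (single x.1 y.1 1) x.2 y.2).PosSemidef := by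
  -- `IsCP` tests only ancillas `Fin k`, so the unnormalized maximally entangled vector pairs `ι`
  -- with its enumeration.
  let q := Fintype.equivFin ι
  let v : ι × Fin (Fintype.card ι) → ℂ := fun x => if q x.1 = x.2 then 1 else 0
  have h1 := (h _ _ (posSemidef_vecMulVec_self_star v)).submatrix
    (fun x : ι × κ => (x.2, q x.1))
  convert h1 using 1
  ext ⟨g, x⟩ ⟨g', x'⟩
  simp only [submatrix_apply, tensorMap_id_right_apply, vecMulVec_apply, Matrix.of_apply, v,
    Pi.star_apply, apply_ite star, star_one, star_zero, EmbeddingLike.apply_eq_iff_eq]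
  simp

theorem tensorMap_maxEnt_apply [Fintype ι] [DecidableEq ι] (Λ : SuperOp ι κ) (g g' : ι)
    (x x' : κ) :
    tensorMap (LinearMap.id : SuperOp ι ι) Λ (maxEnt ι) (g, x) (g', x') =
      (Fintype.card ι : ℂ)⁻¹ * Λ (single g g' 1) x x' := by
  rw [tensorMap_id_left_apply]
  simp [maxEnt_apply]

/-- The output 2-norm depends on `Ω` only through the Gram matrix of its values on matrix units. -/
theorem trace_tensorMap_id [Fintype ι] [DecidableEq ι] [Fintype κ] [Fintype ι'] [DecidableEq ι']
    (Ω : SuperOp ι κ) (ρ : Matrix (ι × ι') (ι × ι') ℂ) :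
    ((tensorMap Ω (LinearMap.id : SuperOp ι' ι') ρ)ᴴ *
        tensorMap Ω (LinearMap.id : SuperOp ι' ι') ρ).trace =
      ∑ x, ∑ x', ∑ g, ∑ g', ∑ h, ∑ h', star (ρ (g, x) (g', x')) * ρ (h, x) (h', x') *
        ((Ω (single g g' 1))ᴴ * Ω (single h h' 1)).trace := by
  have hΩ : ∀ x x' : ι', ∑ k, ∑ l, star (∑ g, ∑ g', ρ (g, x) (g', x') * Ω (single g g' 1) k l) *
      (∑ h, ∑ h', ρ (h, x) (h', x') * Ω (single h h' 1) k l) =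
      ∑ g, ∑ g', ∑ h, ∑ h', star (ρ (g, x) (g', x')) * ρ (h, x) (h', x') *
        ((Ω (single g g' 1))ᴴ * Ω (single h h' 1)).trace := by
    intro x x'
    have e : ∀ g g' h h', ((Ω (single g g' 1))ᴴ * Ω (single h h' 1)).trace =
        ∑ k, ∑ l, star (Ω (single g g' 1) k l) * Ω (single h h' 1) k l := fun g g' h h' => by
      simp only [Matrix.trace, Matrix.diag_apply, Matrix.mul_apply, conjTranspose_apply]
      exact Finset.sum_comm
    simp only [e, star_sum, Finset.mul_sum, Finset.sum_mul, star_mul']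
    rw [sum_sum_comm_sum_sum]
    conv_rhs => rw [sum_sum_comm_sum_sum]
    refine Finset.sum_congr rfl fun g _ => Finset.sum_congr rfl fun g' _ => ?_
    rw [sum_sum_comm_sum_sum]
    refine Finset.sum_congr rfl fun h _ => Finset.sum_congr rfl fun h' _ =>
      Finset.sum_congr rfl fun k _ => Finset.sum_congr rfl fun l _ => ?_
    ring
  simp only [← hΩ]
  simp only [Matrix.trace, Matrix.diag_apply, Matrix.mul_apply, conjTranspose_apply,
    Fintype.sum_prod_type, tensorMap_id_right_apply]
  rw [sum_sum_comm_sum_sum, Finset.sum_comm]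
  refine Finset.sum_congr rfl fun x _ => ?_
  conv_rhs => rw [Finset.sum_comm]; enter [2, k]; rw [Finset.sum_comm]

/-- The images of the matrix units under `Ω` have the Gram matrix of the `n`-th tensor power of a
map with `N† N = a id + b Tr[·] I`, the product basis being labelled through `e`. -/
def HasPowerGram {A : Type*} {n : ℕ} [DecidableEq A] [DecidableEq ι] [Fintype κ]
    (e : A ≃ (Fin n → ι)) (Ω : SuperOp A κ) (a b : ℝ) : Prop :=
  ∀ g g' h h', ((Ω (single g g' 1))ᴴ * Ω (single h h' 1)).trace =
    ∏ k, ((a : ℂ) * (if e g k = e h k ∧ e g' k = e h' k then 1 else 0) +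
      (b : ℂ) * (if e g k = e g' k ∧ e h k = e h' k then 1 else 0))

theorem AdjointSquare.hasPowerGram_tensorPower [Fintype ι] [DecidableEq ι] [Fintype κ]
    {N : SuperOp ι κ} {a b : ℝ} (h : AdjointSquare N a b) (n : ℕ) :
    HasPowerGram (Equiv.refl _) (tensorPower N n) a b := by
  have hs : ∀ g g' : Fin n → ι, tensorPower N n (single g g' 1) =
      Matrix.of fun f f' => ∏ k, N (single (g k) (g' k) 1) (f k) (f' k) := by
    intro g g'
    simp only [tensorPower, LinearMap.coe_mk, AddHom.coe_mk]
    rw [Finset.sum_eq_single g, Finset.sum_eq_single g']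
    · simp
    · intro y _ hy
      simp [single, hy.symm]
    · simp
    · intro y _ hy
      simp [single, hy.symm]
    · simp
  intro g g' x x'
  refine Eq.trans ?_
    (Finset.prod_congr rfl fun k _ => h.trace_single (g k) (g' k) (x k) (x' k))
  simp only [hs]
  simp only [Matrix.trace, Matrix.diag_apply, Matrix.mul_apply, conjTranspose_apply,
    Matrix.of_apply, star_prod, ← Finset.prod_mul_distrib]
  exact sum_sum_prod fun k i j =>
    star (N (single (g k) (g' k) 1) j i) * N (single (x k) (x' k) 1) j i

/-- Treating `N` as the case `n = 1` lets one evaluation serve both `N` and its powers; this is why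
`HasPowerGram` carries a labelling `e`. -/
theorem AdjointSquare.hasPowerGram_self [Fintype ι] [DecidableEq ι] [Fintype κ]
    {N : SuperOp ι κ} {a b : ℝ} (h : AdjointSquare N a b) :
    HasPowerGram (Equiv.funUnique (Fin 1) ι).symm N a b := by
  intro g g' x x'
  rw [h.trace_single]
  simp

/-- Multiplying out, `s` marks the positions where the `a id` term is chosen. The Kronecker deltas
then determine `g'` and `h` from `g` and `h'`, which become the two copies in a partial swap. -/
theorem prod_add_eq_sum_boolWeight {n : ℕ} [DecidableEq ι] (a b : ℝ) (g g' h h' : Fin n → ι) :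
    ∏ k, ((a : ℂ) * (if g k = h k ∧ g' k = h' k then 1 else 0) +
      (b : ℂ) * (if g k = g' k ∧ h k = h' k then 1 else 0)) =
    ∑ s, (boolWeight a b s : ℂ) *
      (if g' = swapOn s g h' then 1 else 0) * (if h = swapOn s h' g then 1 else 0) := by
  have h1 : ∀ k, ((a : ℂ) * (if g k = h k ∧ g' k = h' k then 1 else 0) +
      (b : ℂ) * (if g k = g' k ∧ h k = h' k then 1 else 0)) =
      ∑ s : Bool, ((cond s a b : ℝ) : ℂ) * (if g' k = cond s (h' k) (g k) then 1 else 0) *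
        (if h k = cond s (g k) (h' k) then 1 else 0) := by
    intro k
    rw [Fintype.sum_bool, mul_assoc, mul_assoc, ite_zero_mul_ite_zero, ite_zero_mul_ite_zero]
    simp only [cond_true, cond_false, eq_comm, and_comm, mul_one]
  simp only [h1]
  rw [Fintype.prod_sum]
  refine Finset.sum_congr rfl fun s _ => ?_
  rw [Finset.prod_mul_distrib, Finset.prod_mul_distrib, boolWeight, Complex.ofReal_prod,
    Fintype.prod_ite_zero, Fintype.prod_ite_zero]
  simp [funext_iff, swapOn]

theorem HasPowerGram.trace_eq_sum_swapExp {A : Type*} {n : ℕ} [Fintype A] [DecidableEq A]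
    [Fintype ι] [DecidableEq ι] [Fintype κ] [Fintype ι'] [DecidableEq ι'] [Fintype κ']
    {e : A ≃ (Fin n → ι)} {Ω : SuperOp A κ} {a b : ℝ} (hΩ : HasPowerGram e Ω a b)
    (ρ : Matrix (A × ι') (A × ι') ℂ) (ψ : (Fin n → ι) → ι' → κ' → ℂ)
    (hρ : ∀ g x g' x', ρ (e.symm g, x) (e.symm g', x') = ∑ r, ψ g x r * star (ψ g' x' r)) :
    ((tensorMap Ω (LinearMap.id : SuperOp ι' ι') ρ)ᴴ *
        tensorMap Ω (LinearMap.id : SuperOp ι' ι') ρ).trace =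
      ∑ s, (boolWeight a b s : ℂ) * swapExp ψ s true false := by
  rw [trace_tensorMap_id]
  have h1 : ∀ x x', ∑ g, ∑ g', ∑ h, ∑ h', star (ρ (g, x) (g', x')) * ρ (h, x) (h', x') *
        ((Ω (single g g' 1))ᴴ * Ω (single h h' 1)).trace =
      ∑ s, (boolWeight a b s : ℂ) * ∑ g : Fin n → ι, ∑ h' : Fin n → ι,
        star (ρ (e.symm g, x) (e.symm (swapOn s g h'), x')) *
          ρ (e.symm (swapOn s h' g), x) (e.symm h', x') := by
    intro x x'
    rw [← e.symm.sum_comp]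
    conv_lhs =>
      enter [2, g]
      rw [← e.symm.sum_comp]
      enter [2, g']
      rw [← e.symm.sum_comp]
      enter [2, h]
      rw [← e.symm.sum_comp]
    have hΩ' : ∀ g g' h h' : Fin n → ι, ((Ω (single (e.symm g) (e.symm g') 1))ᴴ *
        Ω (single (e.symm h) (e.symm h') 1)).trace = ∑ s, (boolWeight a b s : ℂ) *
      (if g' = swapOn s g h' then 1 else 0) * (if h = swapOn s h' g then 1 else 0) := by
      intro g g' h h'
      rw [hΩ, ← prod_add_eq_sum_boolWeight]
      simp only [Equiv.apply_symm_apply]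
    simp only [hΩ', Finset.mul_sum]
    conv_rhs => rw [Finset.sum_comm]
    refine Finset.sum_congr rfl fun g _ => ?_
    conv_rhs => rw [Finset.sum_comm]
    conv_lhs => enter [2, g']; rw [Finset.sum_comm]
    rw [Finset.sum_comm]
    refine Finset.sum_congr rfl fun h' _ => ?_
    conv_lhs => enter [2, g']; rw [Finset.sum_comm]
    rw [Finset.sum_comm]
    refine Finset.sum_congr rfl fun s _ => ?_
    rw [Finset.sum_eq_single (swapOn s g h'), Finset.sum_eq_single (swapOn s h' g)]
    · simp; ring
    · intro y _ hy; simp [hy]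
    · simp
    · intro y _ hy; simp [hy]
    · simp
  simp only [h1]
  conv_lhs => enter [2, x]; rw [Finset.sum_comm]
  rw [Finset.sum_comm]
  refine Finset.sum_congr rfl fun s _ => ?_
  simp only [← Finset.mul_sum]
  congr 1
  simp only [swapExp, Fintype.sum_prod_type, hρ, cond_true, cond_false]
  rw [sum_sum_comm_sum_sum]
  refine Finset.sum_congr rfl fun g _ => Finset.sum_congr rfl fun h' _ =>
    Finset.sum_congr rfl fun x _ => Finset.sum_congr rfl fun x' _ => ?_
  rw [star_sum, Finset.sum_mul_sum]
  refine Finset.sum_congr rfl fun r _ => Finset.sum_congr rfl fun r' _ => ?_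
  simp only [star_mul', star_star]
  ring

/-- If the marginal on the first systems is maximally mixed, then so are all smaller marginals. -/
theorem swapExp_false_false {n : ℕ} [Fintype ι] [DecidableEq ι] [Nonempty ι] [Fintype κ]
    [Fintype κ'] (ψ : (Fin n → ι) → κ → κ' → ℂ)
    (hψ : ∀ g g', ∑ x, ∑ r, ψ g x r * star (ψ g' x r) =
      ((Fintype.card ι : ℂ) ^ n)⁻¹ * if g = g' then 1 else 0) (s : Fin n → Bool) :
    swapExp ψ s false false = boolWeight (Fintype.card ι : ℝ)⁻¹ 1 s := by
  have hd : (Fintype.card ι : ℂ) ≠ 0 := Nat.cast_ne_zero.2 Fintype.card_ne_zero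
  have h1 : swapExp ψ s false false = ∑ g, ∑ h,
      (∑ x, ∑ r, ψ (swapOn s g h) x r * star (ψ g x r)) *
      (∑ x, ∑ r, ψ (swapOn s h g) x r * star (ψ h x r)) := by
    simp only [swapExp, Fintype.sum_prod_type, cond_false]
    refine Finset.sum_congr rfl fun g _ => Finset.sum_congr rfl fun h _ => ?_
    rw [Finset.sum_mul_sum]
    refine Finset.sum_congr rfl fun x _ => Finset.sum_congr rfl fun x' _ => ?_
    rw [Finset.sum_mul_sum]
    refine Finset.sum_congr rfl fun r _ => Finset.sum_congr rfl fun r' _ => ?_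
    rw [star_mul']
    ring
  have h2 : ∀ g h : Fin n → ι,
      ((Fintype.card ι : ℂ) ^ n)⁻¹ * (if swapOn s g h = g then 1 else 0) *
        (((Fintype.card ι : ℂ) ^ n)⁻¹ * (if swapOn s h g = h then 1 else 0)) =
      ∏ k, (((Fintype.card ι : ℂ) ^ 2)⁻¹ * if s k → g k = h k then 1 else 0) := by
    intro g h
    -- The two overlaps survive only if `g` and `h` agree on `s`, so the double sum factorizes: a
    -- marked position gives `d⁻² · d`, an unmarked one `d⁻² · d²`, with `d` the cardinality of `ι`.
    have h3 : (swapOn s g h = g ∧ swapOn s h g = h) ↔ ∀ k, s k → g k = h k := by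
      simp only [funext_iff, swapOn, ← forall_and]
      refine forall_congr' fun k => ?_
      cases s k <;> simp [eq_comm]
    rw [mul_mul_mul_comm, ite_zero_mul_ite_zero, Finset.prod_mul_distrib, Fintype.prod_ite_zero]
    simp only [h3, Finset.prod_const, Finset.card_univ, Fintype.card_fin, mul_one, inv_pow,
      one_pow, ← pow_mul]
    congr 1
    ring
  rw [h1]
  simp only [hψ, h2]
  rw [sum_sum_prod fun k i j => (((Fintype.card ι : ℂ) ^ 2)⁻¹ * if s k → i = j then 1 else 0),
    boolWeight, Complex.ofReal_prod]
  refine Finset.prod_congr rfl fun k _ => ?_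
  rcases Bool.eq_false_or_eq_true (s k) with hs | hs
  · simp [hs]; field_simp
  · simp [hs]; field_simp

/-! ### The upper bound, its attainment and the value of υ₂. -/

theorem sum_boolWeight_mul {n : ℕ} (a b c d : ℝ) :
    ∑ s : Fin n → Bool, boolWeight a b s * boolWeight c d s = (a * c + b * d) ^ n := by
  simp only [boolWeight, ← Finset.prod_mul_distrib]
  rw [← Fintype.prod_sum fun (k : Fin n) s => cond s a b * cond s c d]
  simp

open scoped MatrixOrder Matrix.Norms.L2Operator in
theorem exists_eq_conjTranspose_mul_self [Fintype ι] [DecidableEq ι] {M : Matrix ι ι ℂ}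
    (hM : M.PosSemidef) : ∃ B : Matrix ι ι ℂ, M = Bᴴ * B :=
  CStarAlgebra.nonneg_iff_eq_star_mul_self.mp hM.nonneg

theorem HasPowerGram.schattenTwo_le {A : Type*} {n : ℕ} [Fintype A] [DecidableEq A]
    [Fintype ι] [DecidableEq ι] [Nonempty ι] [Fintype κ] {e : A ≃ (Fin n → ι)} {Ω : SuperOp A κ}
    {a b : ℝ} (ha : 0 ≤ a) (hb : 0 ≤ b) (hΩ : HasPowerGram e Ω a b) {m : ℕ}
    {Λ : SuperOp A (Fin m)} (hΛ : IsCPTP Λ) :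
    schattenTwo (tensorMap Ω (LinearMap.id : SuperOp (Fin m) (Fin m))
      (tensorMap (LinearMap.id : SuperOp A A) Λ (maxEnt A))) ≤
      Real.sqrt (max (a + b / Fintype.card ι) (a / Fintype.card ι + b)) ^ n := by
  set ρ := tensorMap (LinearMap.id : SuperOp A A) Λ (maxEnt A) with hρ
  have hcard : Fintype.card A = Fintype.card ι ^ n := by
    rw [Fintype.card_congr e]; simp
  have hpos : ρ.PosSemidef := by
    have h1 : ρ = (Fintype.card A : ℂ)⁻¹ •
        (Matrix.of fun x y : A × Fin m => Λ (single x.1 y.1 1) x.2 y.2) := by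
      ext ⟨g, x⟩ ⟨g', x'⟩
      rw [hρ, tensorMap_maxEnt_apply]
      rfl
    rw [h1]
    refine hΛ.1.posSemidef_choi.smul ?_
    rw [← Complex.ofReal_natCast, ← Complex.ofReal_inv]
    exact_mod_cast inv_nonneg.2 (Nat.cast_nonneg (α := ℝ) _)
  obtain ⟨B, hB⟩ := exists_eq_conjTranspose_mul_self hpos
  -- A purification of ρ: the row index of the factor `B` serves as the purifying system.
  let ψ : (Fin n → ι) → Fin m → A × Fin m → ℂ := fun g x r => star (B r (e.symm g, x))
  have hψ : ∀ g x g' x', ρ (e.symm g, x) (e.symm g', x') = ∑ r, ψ g x r * star (ψ g' x' r) := by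
    intro g x g' x'
    simp only [hB, Matrix.mul_apply, conjTranspose_apply, ψ, star_star]
  -- Trace preservation of `Λ` keeps the marginal on `A` maximally mixed.
  have hmix : ∀ g g', ∑ x, ∑ r, ψ g x r * star (ψ g' x r) =
      ((Fintype.card ι : ℂ) ^ n)⁻¹ * if g = g' then 1 else 0 := by
    intro g g'
    simp only [← hψ, hρ, tensorMap_maxEnt_apply, ← Finset.mul_sum]
    have := hΛ.2 (single (e.symm g) (e.symm g') 1)
    rw [trace_single_one, Matrix.trace] at this
    simp only [Matrix.diag_apply, EmbeddingLike.apply_eq_iff_eq] at this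
    rw [this, hcard]
    push_cast
    rfl
  have hff : ∀ s, (swapExp ψ s false false).re = boolWeight (Fintype.card ι : ℝ)⁻¹ 1 s :=
    fun s => by rw [swapExp_false_false ψ hmix, Complex.ofReal_re]
  have hd : (0 : ℝ) ≤ (Fintype.card ι : ℝ)⁻¹ := by positivity
  have hmax : 0 ≤ max (a + b / Fintype.card ι) (a / Fintype.card ι + b) :=
    le_max_of_le_left (by positivity)
  unfold schattenTwo
  rw [hΩ.trace_eq_sum_swapExp ρ ψ hψ, Complex.re_sum]
  simp only [Complex.re_ofReal_mul]
  refine Real.sqrt_le_iff.2 ⟨by positivity, ?_⟩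
  rw [← pow_mul, mul_comm n 2, pow_mul, Real.sq_sqrt hmax]
  rcases le_total b a with hab | hab
  · refine (sum_boolWeight_swapExp_le ψ hb hab).trans ?_
    simp only [hff, sum_boolWeight_mul]
    refine pow_le_pow_left₀ (by positivity) (le_max_of_le_left (le_of_eq ?_)) n
    ring
  · refine (sum_boolWeight_swapExp_le' ψ ha hab).trans ?_
    simp only [hff, sum_boolWeight_mul]
    refine pow_le_pow_left₀ (by positivity) (le_max_of_le_right (le_of_eq ?_)) n
    ring

/-- Relabelling the basis, as a channel. -/
def relabel [Fintype ι] : SuperOp ι (Fin (Fintype.card ι)) :=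
  (Matrix.reindexLinearEquiv ℂ ℂ (Fintype.equivFin ι) (Fintype.equivFin ι)).toLinearMap

theorem relabel_isCPTP [Fintype ι] [DecidableEq ι] : IsCPTP (relabel (ι := ι)) := by
  refine ⟨isCP_of_kraus _ (fun _ : Unit =>
    (1 : Matrix ι ι ℂ).submatrix (Fintype.equivFin ι).symm id) fun X => ?_, fun X => ?_⟩
  · ext x y
    simp [relabel, Matrix.mul_apply, Matrix.one_apply]
  · simp only [relabel, Matrix.trace, LinearEquiv.coe_coe, coe_reindexLinearEquiv,
      Matrix.diag_apply, reindex_apply, submatrix_apply]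
    exact (Fintype.equivFin ι).symm.sum_comp fun i => X i i

/-- The channel onto the trivial system. -/
def traceOut [Fintype ι] : SuperOp ι (Fin 1) :=
  (Matrix.traceLinearMap ι ℂ ℂ).smulRight 1

theorem traceOut_isCPTP [Fintype ι] [DecidableEq ι] : IsCPTP (traceOut (ι := ι)) := by
  refine ⟨isCP_of_kraus _ (fun i : ι => Matrix.of fun _ j => if j = i then 1 else 0) fun X => ?_,
    fun X => ?_⟩
  · ext x y
    simp [traceOut, Matrix.mul_apply, Matrix.sum_apply, Matrix.trace,
      Subsingleton.elim x y]
  · simp [traceOut]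

theorem HasPowerGram.schattenTwo_relabel {A : Type*} {n : ℕ} [Fintype A] [DecidableEq A]
    [Fintype ι] [DecidableEq ι] [Nonempty ι] [Fintype κ] {e : A ≃ (Fin n → ι)} {Ω : SuperOp A κ}
    {a b : ℝ} (ha : 0 ≤ a) (hb : 0 ≤ b) (hΩ : HasPowerGram e Ω a b) :
    schattenTwo (tensorMap Ω LinearMap.id
      (tensorMap (LinearMap.id : SuperOp A A) relabel (maxEnt A))) =
      Real.sqrt (a + b / Fintype.card ι) ^ n := by
  have hd : (Fintype.card ι : ℂ) ≠ 0 := Nat.cast_ne_zero.2 Fintype.card_ne_zero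
  have hcard : Fintype.card A = Fintype.card ι ^ n := by
    rw [Fintype.card_congr e]; simp
  have hr : ∀ (g g' : A) x x', relabel (single g g' (1 : ℂ)) x x' =
      (if g = (Fintype.equivFin A).symm x then 1 else 0) *
        (if g' = (Fintype.equivFin A).symm x' then 1 else 0) := by
    intro g g' x x'
    simp [relabel, single, ← ite_and, and_comm]
  have key : ((tensorMap Ω LinearMap.id
      (tensorMap (LinearMap.id : SuperOp A A) relabel (maxEnt A)))ᴴ * tensorMap Ω LinearMap.id
      (tensorMap (LinearMap.id : SuperOp A A) relabel (maxEnt A))).trace =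
      (((a + b / Fintype.card ι) ^ n : ℝ) : ℂ) := by
    rw [trace_tensorMap_id]
    simp only [tensorMap_maxEnt_apply, hr, hΩ _ _ _ _]
    rw [← (Fintype.equivFin A).sum_comp]
    conv_lhs => enter [2, x]; rw [← (Fintype.equivFin A).sum_comp]
    simp only [Equiv.symm_apply_apply]
    -- The normalization is shared out as one `d⁻²` per position, with `d` the cardinality of `ι`;
    -- summing a factor over its two indices gives `d⁻²(a d² + b d) = a + b/d`.
    have h1 : ∀ x x' : A, ∑ g, ∑ g', ∑ h, ∑ h',
        star ((Fintype.card A : ℂ)⁻¹ * ((if g = x then 1 else 0) * if g' = x' then 1 else 0)) *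
        ((Fintype.card A : ℂ)⁻¹ * ((if h = x then 1 else 0) * if h' = x' then 1 else 0)) *
        ∏ k, ((a : ℂ) * (if e g k = e h k ∧ e g' k = e h' k then 1 else 0) +
          (b : ℂ) * (if e g k = e g' k ∧ e h k = e h' k then 1 else 0)) =
        ∏ k, (((Fintype.card ι : ℂ) ^ 2)⁻¹ * (a + b * if e x k = e x' k then 1 else 0)) := by
      intro x x'
      rw [Finset.sum_eq_single x, Finset.sum_eq_single x', Finset.sum_eq_single x,
        Finset.sum_eq_single x']
      · rw [Finset.prod_mul_distrib]
        simp only [hcard, if_true, and_self, mul_one, Finset.prod_const, Finset.card_univ,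
          Fintype.card_fin, Nat.cast_pow, star_inv₀, star_pow, star_natCast, ← pow_mul, inv_pow]
        congr 1
        ring
      all_goals simp +contextual
    simp only [h1]
    rw [← e.symm.sum_comp]
    conv_lhs => enter [2, x]; rw [← e.symm.sum_comp]
    simp only [Equiv.apply_symm_apply]
    rw [sum_sum_prod fun (_ : Fin n) i j =>
      ((Fintype.card ι : ℂ) ^ 2)⁻¹ * (a + b * if i = j then 1 else 0)]
    simp [← Finset.mul_sum, Finset.sum_add_distrib]
    congr 1
    field_simp
  rw [schattenTwo, key, Complex.ofReal_re, Real.sqrt_eq_iff_mul_self_eq (by positivity)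
    (by positivity), ← mul_pow, Real.mul_self_sqrt (by positivity)]

theorem HasPowerGram.schattenTwo_traceOut {A : Type*} {n : ℕ} [Fintype A] [DecidableEq A]
    [Fintype ι] [DecidableEq ι] [Nonempty ι] [Fintype κ] {e : A ≃ (Fin n → ι)} {Ω : SuperOp A κ}
    {a b : ℝ} (ha : 0 ≤ a) (hb : 0 ≤ b) (hΩ : HasPowerGram e Ω a b) :
    schattenTwo (tensorMap Ω LinearMap.id
      (tensorMap (LinearMap.id : SuperOp A A) traceOut (maxEnt A))) =
      Real.sqrt (a / Fintype.card ι + b) ^ n := by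
  have hd : (Fintype.card ι : ℂ) ≠ 0 := Nat.cast_ne_zero.2 Fintype.card_ne_zero
  have hcard : Fintype.card A = Fintype.card ι ^ n := by
    rw [Fintype.card_congr e]; simp
  have hr : ∀ (g g' : A) x x', traceOut (single g g' (1 : ℂ)) x x' = if g = g' then 1 else 0 := by
    intro g g' x x'
    simp [traceOut, trace_single_one, Subsingleton.elim x x']
  have key : ((tensorMap Ω LinearMap.id
      (tensorMap (LinearMap.id : SuperOp A A) traceOut (maxEnt A)))ᴴ * tensorMap Ω LinearMap.id
      (tensorMap (LinearMap.id : SuperOp A A) traceOut (maxEnt A))).trace =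
      (((a / Fintype.card ι + b) ^ n : ℝ) : ℂ) := by
    rw [trace_tensorMap_id]
    simp only [tensorMap_maxEnt_apply, hr, hΩ _ _ _ _, Finset.univ_unique, Finset.sum_singleton]
    have h1 : ∀ g : A, ∑ g', ∑ h, ∑ h',
        star ((Fintype.card A : ℂ)⁻¹ * (if g = g' then 1 else 0)) *
        ((Fintype.card A : ℂ)⁻¹ * (if h = h' then 1 else 0)) *
        ∏ k, ((a : ℂ) * (if e g k = e h k ∧ e g' k = e h' k then 1 else 0) +
          (b : ℂ) * (if e g k = e g' k ∧ e h k = e h' k then 1 else 0)) =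
        ∑ h, ∏ k, (((Fintype.card ι : ℂ) ^ 2)⁻¹ * (a * (if e g k = e h k then 1 else 0) + b)) := by
      intro g
      rw [Finset.sum_eq_single g]
      · refine Finset.sum_congr rfl fun h _ => ?_
        rw [Finset.sum_eq_single h]
        · rw [Finset.prod_mul_distrib]
          simp only [hcard, if_true, and_self, mul_one, Finset.prod_const, Finset.card_univ,
            Fintype.card_fin, Nat.cast_pow, star_inv₀, star_pow, star_natCast, ← pow_mul, inv_pow]
          congr 1
          ring
        all_goals simp +contextual [eq_comm]
      all_goals simp +contextual [eq_comm]
    simp only [h1]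
    rw [← e.symm.sum_comp]
    conv_lhs => enter [2, x]; rw [← e.symm.sum_comp]
    simp only [Equiv.apply_symm_apply]
    rw [sum_sum_prod fun (_ : Fin n) i j =>
      ((Fintype.card ι : ℂ) ^ 2)⁻¹ * (a * (if i = j then 1 else 0) + b)]
    simp [← Finset.mul_sum, Finset.sum_add_distrib]
    congr 1
    field_simp
  rw [schattenTwo, key, Complex.ofReal_re, Real.sqrt_eq_iff_mul_self_eq (by positivity)
    (by positivity), ← mul_pow, Real.mul_self_sqrt (by positivity)]

theorem HasPowerGram.isGreatest {A : Type*} {n : ℕ} [Fintype A] [DecidableEq A]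
    [Fintype ι] [DecidableEq ι] [Nonempty ι] [Fintype κ] {e : A ≃ (Fin n → ι)} {Ω : SuperOp A κ}
    {a b : ℝ} (ha : 0 ≤ a) (hb : 0 ≤ b) (hΩ : HasPowerGram e Ω a b) :
    IsGreatest (upsilonTwoValues Ω)
      (Real.sqrt (max (a + b / Fintype.card ι) (a / Fintype.card ι + b)) ^ n) := by
  refine ⟨?_, ?_⟩
  -- Keeping the whole reference system gives one entry of the maximum, discarding it gives the
  -- other.
  · rcases max_choice (a + b / Fintype.card ι) (a / Fintype.card ι + b) with h | h <;> rw [h]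
    · exact ⟨_, relabel, relabel_isCPTP, (hΩ.schattenTwo_relabel ha hb).symm⟩
    · exact ⟨_, traceOut, traceOut_isCPTP, (hΩ.schattenTwo_traceOut ha hb).symm⟩
  · rintro r ⟨m, Λ, hΛ, rfl⟩
    exact hΩ.schattenTwo_le ha hb hΛ

/-- `υ₂` is multiplicative for maps with `N† N = a id + b Tr[·] I`. -/
theorem AdjointSquare.upsilonTwoMultiplicative [Fintype ι] [DecidableEq ι] [Nonempty ι] [Fintype κ]
    {N : SuperOp ι κ} {a b : ℝ} (h : AdjointSquare N a b) : UpsilonTwoMultiplicative N := by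
  have h1 := h.hasPowerGram_self.isGreatest h.1 h.2.1
  have h2 := fun n => (h.hasPowerGram_tensorPower n).isGreatest h.1 h.2.1
  refine ⟨⟨_, h1.2⟩, fun n => ⟨⟨_, (h2 n).2⟩, ?_⟩⟩
  rw [upsilonTwo, upsilonTwo, (h2 n).csSup_eq, h1.csSup_eq, pow_one]

end

end QuantumChannel

/-! ### Checking the parameter ranges. -/

theorem mainTheorem6 (d : ℕ) (hd : 2 ≤ d) :
    (∀ p : ℝ, 0 ≤ p → p ≤ (d : ℝ) ^ 2 / ((d : ℝ) ^ 2 - 1) →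
      QuantumChannel.IsCPTP (QuantumChannel.depol d p) ∧
      QuantumChannel.IsCPTP (QuantumChannel.depolCompl d p) ∧
      QuantumChannel.IsComplementary (QuantumChannel.depol d p) (QuantumChannel.depolCompl d p) ∧
      QuantumChannel.AdjointSquare (QuantumChannel.depol d p) ((1 - p) ^ 2) (p * (2 - p) / d) ∧
      QuantumChannel.AdjointSquare (QuantumChannel.depolCompl d p)
        (p * (2 - p) / d) ((1 - p) ^ 2) ∧
      QuantumChannel.UpsilonTwoMultiplicative (QuantumChannel.depol d p) ∧
      QuantumChannel.UpsilonTwoMultiplicative (QuantumChannel.depolCompl d p)) ∧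
    (∀ t : ℝ, -(1 / ((d : ℝ) - 1)) ≤ t → t ≤ 1 / ((d : ℝ) + 1) →
      QuantumChannel.IsCPTP (QuantumChannel.transDepol d t) ∧
      QuantumChannel.IsCPTP (QuantumChannel.transDepolCompl d t) ∧
      QuantumChannel.IsComplementary (QuantumChannel.transDepol d t)
        (QuantumChannel.transDepolCompl d t) ∧
      QuantumChannel.AdjointSquare (QuantumChannel.transDepol d t) (t ^ 2) ((1 - t ^ 2) / d) ∧
      QuantumChannel.AdjointSquare (QuantumChannel.transDepolCompl d t)
        ((1 - t ^ 2) / d) (t ^ 2) ∧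
      QuantumChannel.UpsilonTwoMultiplicative (QuantumChannel.transDepol d t) ∧
      QuantumChannel.UpsilonTwoMultiplicative (QuantumChannel.transDepolCompl d t)) := by
  have hd0 : d ≠ 0 := by omega
  have : Nonempty (Fin d) := ⟨⟨0, by omega⟩⟩
  have hdR : (2 : ℝ) ≤ d := by exact_mod_cast hd
  refine ⟨fun p hp hp' => ?_, fun t ht ht' => ?_⟩
  · have hpos : (0 : ℝ) < (d : ℝ) ^ 2 - 1 := by nlinarith
    rw [le_div_iff₀ hpos] at hp'
    -- If `p > 2`, then `2(d² - 1) < d²`, contradicting `d ≥ 2`. The bound makes `p(2 - p)/d`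
    -- nonnegative.
    have h2 : p ≤ 2 := by
      by_contra! h
      nlinarith
    have hP : 0 ≤ 1 - p * (((d : ℝ) ^ 2 - 1) / (d : ℝ) ^ 2) := by
      rw [← mul_div_assoc, sub_nonneg, div_le_one (by positivity)]
      exact hp'
    have hc := QuantumChannel.depol_isComplementary hd0 hp hP
    have ha := QuantumChannel.depol_adjointSquare hd0 hp h2
    have hac := hc.adjointSquare ha
    exact ⟨hc.isCPTP.1, hc.isCPTP.2, hc, ha, hac, ha.upsilonTwoMultiplicative,
      hac.upsilonTwoMultiplicative⟩
  · have hpos : (0 : ℝ) < (d : ℝ) - 1 := by linarith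
    have h1 : 0 ≤ 1 + ((d : ℝ) - 1) * t := by
      rw [← neg_div, div_le_iff₀ hpos] at ht
      linarith
    have h2 : 0 ≤ 1 - ((d : ℝ) + 1) * t := by
      rw [le_div_iff₀ (by linarith)] at ht'
      linarith
    have h3 : t ^ 2 ≤ 1 := by
      rw [sq_le_one_iff_abs_le_one, abs_le]
      constructor
      · by_contra! h
        nlinarith
      · by_contra! h
        nlinarith
    have hc := QuantumChannel.transDepol_isComplementary hd0 h1 h2
    have ha := QuantumChannel.transDepol_adjointSquare hd0 h3
    have hac := hc.adjointSquare ha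
    exact ⟨hc.isCPTP.1, hc.isCPTP.2, hc, ha, hac, ha.upsilonTwoMultiplicative,
      hac.upsilonTwoMultiplicative⟩
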